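/- Let $\Sigma$ be a finite alphabet. A weighted finite automaton (WFA) of dimension $n$ is a tuple $A=\langle\alpha_0,\alpha_\infty,\{A_\sigma\}_{\sigma\in\Sigma}\rangle$ with $\alpha_0,\alpha_\infty\in\mathbb{R}^n$ and $A_\sigma\in\mathbb{R}^{n\times n}$; it realizes $f_A:\Sigma^\star\to\mathbb{R}$, $f_A(x_1\cdots x_t)=\alpha_0^\top A_{x_1}\cdots A_{x_t}\alpha_\infty$. A function realized by some WFA is called rational; its rank is the least dimension of a WFA realizing it, and a WFA of this dimension is called minimal. For square matrices $L,R$ write $LAR=\langle R^\top\alpha_0, L\alpha_\infty,\{LA_\sigma R\}\rangle$. A reduced SVD of a (possibly infinite) matrix $M$ of rank $n$ is a factorization $M=UDV^\top$ where $U$ and $V$ have $n$ columns, orthonormal in $\ell^2$, and $D=\mathrm{diag}(\mathfrak{s}_1,\dots,\mathfrak{s}_n)$ with $\mathfrak{s}_1\ge\cdots\ge\mathfrak{s}_n>0$. The Hankel singular values of $f$ are the singular values $\mathfrak{s}_1\ge\cdots\ge\mathfrak{s}_n$ in a reduced SVD of the Hankel matrix $H_f\in\mathbb{R}^{\Sigma^\star\times\Sigma^\star}$,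 $H_f(p,q)=f(pq)$. For a minimal WFA $A$ of dimension $n$ put $A^\otimes=\sum_\sigma A_\sigma\otimes A_\sigma$. If the spectral radius satisfies $\rho(A^\otimes)<1$ and $\hat n<n$, the algorithm SVATruncation$(A,\hat n)$ does the following. 1. Compute $G_p,G_s\in\mathbb{R}^{n\times n}$ from $\mathrm{vec}(G_p)^\top=(\alpha_0\otimes\alpha_0)^\top(I-A^\otimes)^{-1}$ and $\mathrm{vec}(G_s)=(I-A^\otimes)^{-1}(\alpha_\infty\otimes\alpha_\infty)$. 2. Take spectral decompositions $G_p=V_pD_pV_p^\top$ and $G_s=V_sD_sV_s^\top$ (with $V_p,V_s$ orthogonal) and a reduced SVD $D_p^{1/2}V_p^\top V_sD_s^{1/2}=\tilde U D\tilde V^\top$ with $D$ of size $n\times n$; put $Q_p=V_pD_p^{-1/2}\tilde U$, $Q_s=V_sD_s^{-1/2}\tilde V$ and $A'=D^{1/2}Q_s^\top\,A\,Q_pD^{1/2}=\langle\alpha_0',\alpha_\infty',\{A'_\sigma\}\rangle$. 3. With $\Pi=[I_{\hat n}\ 0]\in\mathbb{R}^{\hat n\times n}$, return $\hat A=\langle\Pi\alpha_0',\Pi\alpha_\infty',\{\Pi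 A'_\sigma\Pi^\top\}\rangle$. **Theorem.** Let $f:\Sigma^\star\to\mathbb{R}$ be rational of rank $n$ with $\sum_x|f(x)|<\infty$. Then $f$ has Hankel singular values $\mathfrak{s}_1\ge\cdots\ge\mathfrak{s}_n>0$, and there is a constant $C_f>0$, depending only on $f$, such that for every $0<\hat n<n$ and every minimal WFA $A$ realizing $f$ with $\rho(A^\otimes)<1$ the following holds: all steps of SVATruncation$(A,\hat n)$ can be carried out, and, for every choice of the decompositions in step 2, the function $\hat f$ realized by the output $\hat A$ satisfies $$\|f-\hat f\|_2^2=\sum_{x\in\Sigma^\star}(f(x)-\hat f(x))^2\le C_f\sqrt{\mathfrak{s}_{\hat n+1}+\cdots+\mathfrak{s}_n}.$$ -/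

import Mathlib

open scoped Matrix Kronecker

noncomputable section

/-- A weighted finite automaton with real weights and states `Fin n` over the alphabet `α`. -/
structure WFA (α : Type*) (n : ℕ) where
  /-- initial weights -/
  init : Fin n → ℝ
  /-- final weights -/
  final : Fin n → ℝ
  /-- transition weights -/
  trans : α → Matrix (Fin n) (Fin n) ℝ

/-- The transition matrix of a string `x₁ ⋯ x_t`, i.e. the product `A_{x₁} ⋯ A_{x_t}`. -/
def WFA.word {α : Type*} {n : ℕ} (A : WFA α n) (x : List α) : Matrix (Fin n) (Fin n) ℝ :=
  (x.map A.trans).prod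

/-- The function on strings realized by the automaton. -/
def WFA.fn {α : Type*} {n : ℕ} (A : WFA α n) (x : List α) : ℝ :=
  A.init ⬝ᵥ (A.word x *ᵥ A.final)

/-- `f` is rational if some WFA realizes it. -/
def IsRational {α : Type*} (f : List α → ℝ) : Prop :=
  ∃ (m : ℕ) (A : WFA α m), A.fn = f

/-- The rank of a rational function: the least dimension of a WFA realizing it. -/
def seriesRank {α : Type*} (f : List α → ℝ) : ℕ :=
  sInf {m : ℕ | ∃ A : WFA α m, A.fn = f}

/-- A WFA is minimal if its dimension is the rank of the function it realizes. -/
def WFA.IsMinimal {α : Type*} {n : ℕ} (A : WFA α n) : Prop :=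
  n = seriesRank A.fn

/-- The bi-infinite Hankel matrix `H_f(p, q) = f(pq)`. -/
def hankel {α : Type*} (f : List α → ℝ) : Matrix (List α) (List α) ℝ :=
  Matrix.of fun p q => f (p ++ q)

/-- `M = U diag(s) Vᵀ` is a reduced singular value decomposition with inner dimension `n`:
the columns of `U` and of `V` are orthonormal in `ℓ²`, and `s₁ ≥ ⋯ ≥ s_n > 0`.
The index sets `I`, `J` of `M` may be infinite. -/
structure IsReducedSVD {I J : Type*} {n : ℕ} (M : Matrix I J ℝ) (U : Matrix I (Fin n) ℝ)
    (s : Fin n → ℝ) (V : Matrix J (Fin n) ℝ) : Prop where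
  pos : ∀ i, 0 < s i
  antitone : Antitone s
  left_orthonormal : ∀ i j, HasSum (fun x => U x i * U x j) (if i = j then 1 else 0)
  right_orthonormal : ∀ i j, HasSum (fun y => V y i * V y j) (if i = j then 1 else 0)
  eq : ∀ x y, M x y = ∑ i, U x i * s i * V y i

/-- `s₁ ≥ ⋯ ≥ s_n > 0` are the Hankel singular values of `f`. -/
def IsHankelSingularValues {α : Type*} {n : ℕ} (f : List α → ℝ) (s : Fin n → ℝ) : Prop :=
  ∃ U V : Matrix (List α) (Fin n) ℝ, IsReducedSVD (hankel f) U s V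

/-- The matrix `∑_σ A_σ ⊗ A_σ`. -/
def WFA.tensorSq {α : Type*} [Fintype α] {n : ℕ} (A : WFA α n) :
    Matrix (Fin n × Fin n) (Fin n × Fin n) ℝ :=
  ∑ a, A.trans a ⊗ₖ A.trans a

/-- The spectral radius of a real square matrix: the largest modulus of a complex eigenvalue. -/
def matrixSpectralRadius {ι : Type*} [Fintype ι] [DecidableEq ι] (M : Matrix ι ι ℝ) :
    ENNReal :=
  spectralRadius ℂ (M.map Complex.ofReal)

/-- The matrix `G_p` with `vec(G_p)ᵀ = (α₀ ⊗ α₀)ᵀ (I - ∑_σ A_σ ⊗ A_σ)⁻¹`. -/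
def WFA.gramP {α : Type*} [Fintype α] {n : ℕ} (A : WFA α n) : Matrix (Fin n) (Fin n) ℝ :=
  Matrix.of fun i j =>
    ((fun k : Fin n × Fin n => A.init k.1 * A.init k.2) ᵥ* (1 - A.tensorSq)⁻¹) (i, j)

/-- The matrix `G_s` with `vec(G_s) = (I - ∑_σ A_σ ⊗ A_σ)⁻¹ (α_∞ ⊗ α_∞)`. -/
def WFA.gramS {α : Type*} [Fintype α] {n : ℕ} (A : WFA α n) : Matrix (Fin n) (Fin n) ℝ :=
  Matrix.of fun i j =>
    ((1 - A.tensorSq)⁻¹ *ᵥ (fun k : Fin n × Fin n => A.final k.1 * A.final k.2)) (i, j)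

/-- `G = W diag(d) Wᵀ` is a spectral decomposition with `W` orthogonal. -/
def IsSpectralDecomposition {n : ℕ} (G W : Matrix (Fin n) (Fin n) ℝ) (d : Fin n → ℝ) : Prop :=
  W ∈ Matrix.orthogonalGroup (Fin n) ℝ ∧ G = W * Matrix.diagonal d * Wᵀ

/-- The WFA `L A R = ⟨Rᵀ α₀, L α_∞, {L A_σ R}⟩`; it is the conjugate `Q⁻¹ A Q` when `R = Q`
and `L = Q⁻¹`. -/
def WFA.transform {α : Type*} {n m : ℕ} (A : WFA α n) (L : Matrix (Fin m) (Fin n) ℝ)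
    (R : Matrix (Fin n) (Fin m) ℝ) : WFA α m where
  init := Rᵀ *ᵥ A.init
  final := L *ᵥ A.final
  trans a := L * A.trans a * R

/-- `A'` is an output of ComputeSVA on input `A`. The algorithm picks spectral decompositions
`G_p = V_p D_p V_pᵀ`, `G_s = V_s D_s V_sᵀ` and a reduced SVD `Ũ D Ṽᵀ` of
`D_p^{1/2} V_pᵀ V_s D_s^{1/2}`; with `Q_p = V_p D_p^{-1/2} Ũ` and `Q_s = V_s D_s^{-1/2} Ṽ`
it returns `D^{1/2} Q_sᵀ A Q_p D^{1/2}`. Every such choice is allowed. -/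
def ComputeSVA {α : Type*} [Fintype α] {n : ℕ} (A A' : WFA α n) : Prop :=
  ∃ (Vp Vs U V : Matrix (Fin n) (Fin n) ℝ) (dp ds d : Fin n → ℝ),
    IsSpectralDecomposition A.gramP Vp dp ∧
    IsSpectralDecomposition A.gramS Vs ds ∧
    IsReducedSVD
      (Matrix.diagonal (fun i => √(dp i)) * Vpᵀ * Vs * Matrix.diagonal (fun i => √(ds i)))
      U d V ∧
    A' = A.transform
      (Matrix.diagonal (fun i => √(d i)) *
        (Vs * Matrix.diagonal (fun i => (√(ds i))⁻¹) * V)ᵀ)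
      ((Vp * Matrix.diagonal (fun i => (√(dp i))⁻¹) * U) *
        Matrix.diagonal (fun i => √(d i)))

/-- The `m × n` matrix `Π = [I_m 0]`. -/
def truncMatrix (m n : ℕ) : Matrix (Fin m) (Fin n) ℝ :=
  Matrix.of fun i j => if (i : ℕ) = (j : ℕ) then 1 else 0

/-- `B` is an output of SVATruncation on input `A` and `m`: for an output `A'` of ComputeSVA,
`B = ⟨Π α₀', Π α_∞', {Π A'_σ Πᵀ}⟩`. -/
def SVATruncation {α : Type*} [Fintype α] {n : ℕ} (A : WFA α n) (m : ℕ) (B : WFA α m) : Prop :=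
  ∃ A' : WFA α n, ComputeSVA A A' ∧ B = A'.transform (truncMatrix m n) (truncMatrix m n)ᵀ

end

/-!
Conjugating a minimal automaton by the matrices of the algorithm balances it: the forward vectors
`α₀ᵀ A_x` and the backward vectors `A_x α_∞` get the same Gram matrix `diag(s)`, where `s` are the
Hankel singular values. The difference between such an automaton and its truncation telescopes into
one term for each position at which the word can be cut, namely the product of the forward vector of
the prefix with the discarded coordinates of a backward vector of the suffix. This is a convolution
over the free monoid, so Young's inequality bounds its `ℓ²` norm by the `ℓ¹` norm of the forward
vectors times the `ℓ²` norm of the discarded coordinates. The Stein equation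
`G = α_∞ α_∞ᵀ + ∑ A_σ G A_σᵀ` makes `G = diag(s)` a Lyapunov function, which bounds the latter norm,
squared, by the sum of the discarded singular values. The forward norm depends on `f` only: the
squared lengths of the balanced forward vectors are the diagonal entries of `(H Hᵀ)^{1/2}`.

Summability of `f` makes `I - A^⊗` invertible. If `X = ∑ A_σᵀ X A_σ`, then splitting the
absolutely convergent sum of `(A_{xp} α_∞)ᵀ X (A_{xq} α_∞)` over `x` at the first letter of `x`
shows that its term at the empty word vanishes; by minimality `X = 0`.
-/

noncomputable section

open Finset

/-! ### Gram matrices and reduced singular value decompositions -/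

section TransposeMul

variable {I J ι κ μ : Type*}

/-- `Uᵀ * V = G` for matrices whose row index `I` may be infinite: the `ℓ²` inner products of the
columns of `U` with those of `V` converge to the entries of `G`. In particular
`HasTransposeMul U U G` says that `G` is the Gram matrix of the columns of `U`. -/
def HasTransposeMul (U : Matrix I ι ℝ) (V : Matrix I κ ℝ) (G : Matrix ι κ ℝ) : Prop :=
  ∀ i j, HasSum (fun x => U x i * V x j) (G i j)

variable {U : Matrix I ι ℝ} {V : Matrix I κ ℝ} {G G' : Matrix ι κ ℝ}

theorem hasTransposeMul_iff [Fintype I] : HasTransposeMul U V G ↔ Uᵀ * V = G := by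
  refine ⟨fun h => Matrix.ext fun i j => (hasSum_fintype _).unique (h i j), ?_⟩
  rintro rfl i j
  exact hasSum_fintype _

theorem exists_hasTransposeMul_of_summable_abs (hU : ∀ i, Summable fun x => |U x i|)
    (hV : ∀ j, Summable fun x => |V x j|) : ∃ G, HasTransposeMul U V G := by
  refine ⟨.of fun i j => ∑' x, U x i * V x j, fun i j => Summable.hasSum ?_⟩
  exact (summable_mul_of_summable_norm (f := fun x => U x i) (g := fun x => V x j) (hU i)
    (hV j)).comp_injective (i := fun x => (x, x))
      fun _ _ h => congrArg Prod.fst h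

namespace HasTransposeMul

theorem unique (h : HasTransposeMul U V G) (h' : HasTransposeMul U V G') : G = G' :=
  Matrix.ext fun i j => (h i j).unique (h' i j)

theorem transpose (h : HasTransposeMul U V G) : HasTransposeMul V U Gᵀ := fun i j => by
  simpa only [mul_comm, Matrix.transpose_apply] using h j i

theorem isSymm {G : Matrix ι ι ℝ} (h : HasTransposeMul U U G) : G.IsSymm :=
  h.transpose.unique h

theorem mul_right [Fintype κ] (h : HasTransposeMul U V G) (R : Matrix κ μ ℝ) :
    HasTransposeMul U (V * R) (G * R) := fun i j => by
  simpa only [Matrix.mul_apply, mul_sum, mul_assoc] using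
    hasSum_sum fun k (_ : k ∈ univ) => (h i k).mul_right (R k j)

theorem mul_left [Fintype ι] (h : HasTransposeMul U V G) (L : Matrix ι μ ℝ) :
    HasTransposeMul (U * L) V (Lᵀ * G) := by
  simpa only [Matrix.transpose_mul, Matrix.transpose_transpose] using
    (h.transpose.mul_right L).transpose

theorem submatrix (h : HasTransposeMul U V G) (e : J ≃ I) :
    HasTransposeMul (U.submatrix e id) (V.submatrix e id) G :=
  fun i j => (e.hasSum_iff (f := fun x => U x i * V x j)).2 (h i j)

theorem exists_of_gram {G : Matrix ι ι ℝ} {G' : Matrix κ κ ℝ} (hU : HasTransposeMul U U G)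
    (hV : HasTransposeMul V V G') : ∃ K, HasTransposeMul U V K := by
  refine ⟨.of fun i j => ∑' x, U x i * V x j, fun i j => Summable.hasSum ?_⟩
  refine .of_norm_bounded ((hU i i).summable.add (hV j j).summable) fun x => ?_
  rw [Real.norm_eq_abs, abs_le]
  constructor <;> nlinarith [sq_nonneg (U x i + V x j), sq_nonneg (U x i - V x j),
    sq_nonneg (U x i), sq_nonneg (V x j)]

theorem hasSum_sq_mulVec [Fintype ι] {G : Matrix ι ι ℝ} (h : HasTransposeMul U U G)
    (y : ι → ℝ) : HasSum (fun x => (U *ᵥ y) x ^ 2) (y ⬝ᵥ G *ᵥ y) := by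
  have hy := (h.mul_right (.replicateCol Unit y)).mul_left (.replicateCol Unit y) () ()
  simp only [← Matrix.replicateCol_mulVec, Matrix.replicateCol_apply, ← sq] at hy
  exact hy

theorem posDef [Fintype ι] {G : Matrix ι ι ℝ} (h : HasTransposeMul U U G)
    (hU : ∀ y, U *ᵥ y = 0 → y = 0) : G.PosDef := by
  refine .of_dotProduct_mulVec_pos h.isSymm fun y hy => ?_
  rw [star_trivial]
  have hq := h.hasSum_sq_mulVec y
  refine (hq.nonneg fun x => sq_nonneg _).lt_of_ne' fun h0 => hy (hU y ?_)
  rw [h0, hasSum_zero_iff_of_nonneg fun x => sq_nonneg _] at hq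
  exact funext fun x => by simpa using congrFun hq x

end HasTransposeMul

end TransposeMul

section ReducedSVD

theorem eq_of_antitone_of_map_univ_eq {β : Type*} [PartialOrder β] {n : ℕ} {s s' : Fin n → β}
    (hs : Antitone s) (hs' : Antitone s') (h : univ.val.map s = univ.val.map s') : s = s' := by
  rw [Fin.univ_val_map, Fin.univ_val_map, Multiset.coe_eq_coe] at h
  exact List.ofFn_injective (h.eq_of_sortedGE hs.sortedGE_ofFn hs'.sortedGE_ofFn)

theorem diagonal_mul_eq_mul_diagonal_of_swap {ι κ : Type*} [Fintype ι] [DecidableEq ι] [Fintype κ]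
    [DecidableEq κ] {s : ι → ℝ} {s' : κ → ℝ} {K L : Matrix ι κ ℝ} (hs : ∀ i, 0 < s i)
    (hs' : ∀ j, 0 < s' j) (hKL : Matrix.diagonal s * K = L * Matrix.diagonal s')
    (hLK : Matrix.diagonal s * L = K * Matrix.diagonal s') :
    Matrix.diagonal s * K = K * Matrix.diagonal s' := by
  simp only [← Matrix.ext_iff, Matrix.diagonal_mul, Matrix.mul_diagonal] at hKL hLK ⊢
  intro i j
  have hfactor : (s i * K i j - K i j * s' j) * (s i + s' j) = 0 := by
    linear_combination s i * hKL i j + s' j * hLK i j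
  exact sub_eq_zero.1 ((mul_eq_zero.1 hfactor).resolve_right (add_pos (hs i) (hs' j)).ne')

variable {I J : Type*} {n : ℕ} {M : Matrix I J ℝ} {U U' : Matrix I (Fin n) ℝ}
  {V V' : Matrix J (Fin n) ℝ} {s s' : Fin n → ℝ}

theorem isReducedSVD_iff : IsReducedSVD M U s V ↔ (∀ i, 0 < s i) ∧ Antitone s ∧
    HasTransposeMul U U 1 ∧ HasTransposeMul V V 1 ∧ M = U * Matrix.diagonal s * Vᵀ := by
  simp only [HasTransposeMul, ← Matrix.ext_iff, Matrix.one_apply, Matrix.mul_apply (N := Vᵀ),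
    Matrix.mul_diagonal, Matrix.transpose_apply]
  exact ⟨fun h => ⟨h.pos, h.antitone, h.left_orthonormal, h.right_orthonormal, h.eq⟩,
    fun ⟨hpos, hanti, hU, hV, hM⟩ => ⟨hpos, hanti, hU, hV, hM⟩⟩

namespace IsReducedSVD

theorem transpose (h : IsReducedSVD M U s V) : IsReducedSVD Mᵀ V s U := by
  obtain ⟨hpos, hanti, hU, hV, hM⟩ := isReducedSVD_iff.1 h
  refine isReducedSVD_iff.2 ⟨hpos, hanti, hV, hU, ?_⟩
  simp only [hM, Matrix.transpose_mul, Matrix.transpose_transpose, Matrix.diagonal_transpose,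
    Matrix.mul_assoc]

theorem diagonal_mul_transpose_eq (h : IsReducedSVD M U s V) (h' : IsReducedSVD M U' s' V')
    {K : Matrix (Fin n) (Fin n) ℝ} (hK : HasTransposeMul U U' K) :
    Matrix.diagonal s * Vᵀ = K * (Matrix.diagonal s' * V'ᵀ) := by
  obtain ⟨-, -, hU, -, hM⟩ := isReducedSVD_iff.1 h
  obtain ⟨-, -, -, -, hM'⟩ := isReducedSVD_iff.1 h'
  have hUM := hU.mul_right (Matrix.diagonal s * Vᵀ)
  rw [← Matrix.mul_assoc, ← hM, Matrix.one_mul] at hUM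
  refine hUM.unique ?_
  rw [hM', Matrix.mul_assoc]
  exact hK.mul_right _

theorem diagonal_mul_eq (h : IsReducedSVD M U s V) (h' : IsReducedSVD M U' s' V')
    {K L : Matrix (Fin n) (Fin n) ℝ} (hK : HasTransposeMul U U' K) (hL : HasTransposeMul V V' L) :
    Matrix.diagonal s * L = K * Matrix.diagonal s' := by
  obtain ⟨-, -, -, hV', -⟩ := isReducedSVD_iff.1 h'
  have hVs : V * Matrix.diagonal s = V' * (K * Matrix.diagonal s')ᵀ := by
    simpa only [Matrix.transpose_mul, Matrix.transpose_transpose, Matrix.diagonal_transpose,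
      Matrix.mul_assoc] using congrArg Matrix.transpose (h.diagonal_mul_transpose_eq h' hK)
  have hVV' := hL.mul_left (Matrix.diagonal s)
  rw [Matrix.diagonal_transpose, hVs] at hVV'
  refine hVV'.unique ?_
  simpa only [Matrix.transpose_transpose, Matrix.mul_one] using
    hV'.mul_left (K * Matrix.diagonal s')ᵀ

theorem exists_intertwiner (h : IsReducedSVD M U s V) (h' : IsReducedSVD M U' s' V') :
    ∃ K : Matrix (Fin n) (Fin n) ℝ, K * Kᵀ = 1 ∧ U = U' * Kᵀ ∧
      Matrix.diagonal s * K = K * Matrix.diagonal s' := by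
  obtain ⟨hpos, -, hU, hV, -⟩ := isReducedSVD_iff.1 h
  obtain ⟨hpos', -, hU', hV', -⟩ := isReducedSVD_iff.1 h'
  obtain ⟨K, hK⟩ := hU.exists_of_gram hU'
  obtain ⟨L, hL⟩ := hV.exists_of_gram hV'
  have hsL := h.diagonal_mul_eq h' hK hL
  have hsK := h.transpose.diagonal_mul_eq h'.transpose hL hK
  have hcomm := diagonal_mul_eq_mul_diagonal_of_swap hpos hpos' hsK hsL
  have hUs : Matrix.diagonal s * Uᵀ = Matrix.diagonal s * (K * U'ᵀ) := by
    rw [h.transpose.diagonal_mul_transpose_eq h'.transpose hL, ← Matrix.mul_assoc, ← hsK,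
      Matrix.mul_assoc]
  have hUK : Uᵀ = K * U'ᵀ := by
    ext i x
    have hi := congrFun₂ hUs i x
    rw [Matrix.diagonal_mul, Matrix.diagonal_mul] at hi
    exact mul_left_cancel₀ (hpos i).ne' hi
  have hUK' : U = U' * Kᵀ := by
    simpa only [Matrix.transpose_mul, Matrix.transpose_transpose] using
      congrArg Matrix.transpose hUK
  refine ⟨K, ?_, hUK', hcomm⟩
  have hKK := hK.transpose.mul_left Kᵀ
  rw [← hUK', Matrix.transpose_transpose] at hKK
  exact hKK.unique hU

theorem singularValues_unique (h : IsReducedSVD M U s V) (h' : IsReducedSVD M U' s' V') :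
    s = s' := by
  obtain ⟨K, hKK, -, hcomm⟩ := h.exists_intertwiner h'
  have hs : Matrix.diagonal s = K * (Matrix.diagonal s' * Kᵀ) := by
    rw [← Matrix.mul_assoc, ← hcomm, Matrix.mul_assoc, hKK, Matrix.mul_one]
  have hcharpoly := congrArg Matrix.charpoly hs
  rw [Matrix.charpoly_mul_comm, Matrix.mul_assoc, mul_eq_one_comm.1 hKK, Matrix.mul_one,
    Matrix.charpoly_diagonal, Matrix.charpoly_diagonal] at hcharpoly
  refine eq_of_antitone_of_map_univ_eq h.antitone h'.antitone ?_
  have hroots : ∀ t : Fin n → ℝ,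
      (∏ i, (Polynomial.X - Polynomial.C (t i))).roots = univ.val.map t := fun t => by
    rw [← Polynomial.roots_multiset_prod_X_sub_C (univ.val.map t), Multiset.map_map]
    rfl
  rw [← hroots, hcharpoly, hroots]

theorem polar_unique (h : IsReducedSVD M U s V) (h' : IsReducedSVD M U' s' V') :
    U * Matrix.diagonal s * Uᵀ = U' * Matrix.diagonal s' * U'ᵀ := by
  obtain ⟨K, hKK, hU, hcomm⟩ := h.exists_intertwiner h'
  calc U * Matrix.diagonal s * Uᵀ = U' * (Kᵀ * (Matrix.diagonal s * K)) * U'ᵀ := by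
        simp only [hU, Matrix.transpose_mul, Matrix.transpose_transpose, Matrix.mul_assoc]
    _ = U' * Matrix.diagonal s' * U'ᵀ := by
        rw [hcomm, ← Matrix.mul_assoc Kᵀ, mul_eq_one_comm.1 hKK, Matrix.one_mul]

end IsReducedSVD

end ReducedSVD

section Diagonal

variable {ι : Type*} [Fintype ι] [DecidableEq ι] {d : ι → ℝ}

theorem diagonal_sqrt_mul_diagonal_sqrt (hd : ∀ i, 0 ≤ d i) :
    (Matrix.diagonal fun i => √(d i)) * (Matrix.diagonal fun i => √(d i)) = Matrix.diagonal d := by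
  rw [Matrix.diagonal_mul_diagonal]
  exact congrArg _ (funext fun i => Real.mul_self_sqrt (hd i))

theorem diagonal_inv_sqrt_mul_diagonal_sqrt (hd : ∀ i, 0 < d i) :
    (Matrix.diagonal fun i => (√(d i))⁻¹) * (Matrix.diagonal fun i => √(d i)) = 1 := by
  rw [Matrix.diagonal_mul_diagonal, ← Matrix.diagonal_one]
  exact congrArg _ (funext fun i => inv_mul_cancel₀ (Real.sqrt_pos.2 (hd i)).ne')

theorem HasTransposeMul.mul_diagonal_inv_sqrt {I : Type*} {P : Matrix I ι ℝ} (hd : ∀ i, 0 < d i)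
    (hP : HasTransposeMul P P (Matrix.diagonal d)) :
    HasTransposeMul (P * Matrix.diagonal fun i => (√(d i))⁻¹)
      (P * Matrix.diagonal fun i => (√(d i))⁻¹) 1 := by
  have hgram := (hP.mul_right (Matrix.diagonal fun i => (√(d i))⁻¹)).mul_left
    (Matrix.diagonal fun i => (√(d i))⁻¹)
  have hE := diagonal_inv_sqrt_mul_diagonal_sqrt hd
  rwa [← diagonal_sqrt_mul_diagonal_sqrt fun i => (hd i).le, Matrix.diagonal_transpose,
    Matrix.mul_assoc, mul_eq_one_comm.1 hE, Matrix.mul_one, hE] at hgram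

theorem isReducedSVD_mul_transpose {I J : Type*} {n : ℕ} {d : Fin n → ℝ}
    {P : Matrix I (Fin n) ℝ} {S : Matrix J (Fin n) ℝ} (hd : ∀ i, 0 < d i) (hanti : Antitone d)
    (hP : HasTransposeMul P P (Matrix.diagonal d)) (hS : HasTransposeMul S S (Matrix.diagonal d)) :
    IsReducedSVD (P * Sᵀ) (P * Matrix.diagonal fun i => (√(d i))⁻¹) d
      (S * Matrix.diagonal fun i => (√(d i))⁻¹) := by
  refine isReducedSVD_iff.2
    ⟨hd, hanti, hP.mul_diagonal_inv_sqrt hd, hS.mul_diagonal_inv_sqrt hd, ?_⟩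
  have hE := diagonal_inv_sqrt_mul_diagonal_sqrt hd
  set E := Matrix.diagonal fun i => √(d i)
  set E' := Matrix.diagonal fun i => (√(d i))⁻¹
  calc P * Sᵀ = P * (E' * E) * (E * E') * Sᵀ := by
        rw [hE, mul_eq_one_comm.1 hE, Matrix.mul_one, Matrix.mul_one]
    _ = P * E' * (E * E) * (E' * Sᵀ) := by simp only [Matrix.mul_assoc]
    _ = P * E' * Matrix.diagonal d * (S * E')ᵀ := by
        rw [diagonal_sqrt_mul_diagonal_sqrt fun i => (hd i).le, Matrix.transpose_mul,
          Matrix.diagonal_transpose]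

end Diagonal

section SpectralDecomposition

variable {n : ℕ} {G W : Matrix (Fin n) (Fin n) ℝ} {d : Fin n → ℝ}

theorem exists_isSpectralDecomposition (hG : G.IsHermitian) :
    ∃ W d, IsSpectralDecomposition G W d := by
  refine ⟨hG.eigenvectorUnitary, hG.eigenvalues, hG.eigenvectorUnitary.2, ?_⟩
  conv_lhs => rw [hG.spectral_theorem, Unitary.conjStarAlgAut_apply]
  rfl

namespace IsSpectralDecomposition

theorem transpose_mul_self (h : IsSpectralDecomposition G W d) : Wᵀ * W = 1 :=
  (Matrix.mem_orthogonalGroup_iff' (Fin n) ℝ).1 h.1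

theorem transpose_mul_mul_self (h : IsSpectralDecomposition G W d) :
    Wᵀ * G * W = Matrix.diagonal d := by
  rw [h.2]
  calc Wᵀ * (W * Matrix.diagonal d * Wᵀ) * W
      = (Wᵀ * W) * Matrix.diagonal d * (Wᵀ * W) := by simp only [Matrix.mul_assoc]
    _ = Matrix.diagonal d := by rw [h.transpose_mul_self, Matrix.one_mul, Matrix.mul_one]

theorem pos (h : IsSpectralDecomposition G W d) (hG : G.PosDef) (i : Fin n) : 0 < d i := by
  have hW : Function.Injective (W *ᵥ ·) :=
    Function.LeftInverse.injective (g := (Wᵀ *ᵥ ·)) fun y => by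
      simp only [Matrix.mulVec_mulVec, h.transpose_mul_self, Matrix.one_mulVec]
  have hdiag := hG.conjTranspose_mul_mul_same hW
  rw [Matrix.conjTranspose_eq_transpose_of_trivial, h.transpose_mul_mul_self] at hdiag
  exact Matrix.posDef_diagonal_iff.1 hdiag i

theorem submatrix (h : IsSpectralDecomposition G W d) (σ : Equiv.Perm (Fin n)) :
    IsSpectralDecomposition G (W.submatrix id σ) (d ∘ σ) := by
  constructor
  · rw [Matrix.mem_orthogonalGroup_iff', Matrix.transpose_submatrix,
      ← Matrix.submatrix_mul _ _ _ id _ Function.bijective_id, h.transpose_mul_self,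
      Matrix.submatrix_one_equiv]
  · rw [← Matrix.submatrix_diagonal_equiv, Matrix.transpose_submatrix,
      Matrix.submatrix_mul_equiv, Matrix.submatrix_mul_equiv, Matrix.submatrix_id_id, ← h.2]

theorem sqrt_mul_transpose (h : IsSpectralDecomposition G W d) (hd : ∀ i, 0 ≤ d i) :
    (W * Matrix.diagonal fun i => √(d i)) * (W * Matrix.diagonal fun i => √(d i))ᵀ = G := by
  rw [Matrix.transpose_mul, Matrix.diagonal_transpose, ← Matrix.mul_assoc, Matrix.mul_assoc W,
    diagonal_sqrt_mul_diagonal_sqrt hd, ← h.2]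

theorem inv_sqrt_transpose_mul_sqrt (h : IsSpectralDecomposition G W d) (hd : ∀ i, 0 < d i) :
    (W * Matrix.diagonal fun i => (√(d i))⁻¹)ᵀ * (W * Matrix.diagonal fun i => √(d i)) = 1 := by
  rw [Matrix.transpose_mul, Matrix.diagonal_transpose, Matrix.mul_assoc, ← Matrix.mul_assoc Wᵀ,
    h.transpose_mul_self, Matrix.one_mul, diagonal_inv_sqrt_mul_diagonal_sqrt hd]

end IsSpectralDecomposition

theorem exists_antitone_isSpectralDecomposition (hG : G.IsHermitian) :
    ∃ W d, Antitone d ∧ IsSpectralDecomposition G W d := by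
  obtain ⟨W, d, h⟩ := exists_isSpectralDecomposition hG
  have hmono := Tuple.monotone_sort fun i => -d i
  exact ⟨_, _, fun i j hij => neg_le_neg_iff.1 (hmono hij), h.submatrix (Tuple.sort fun i => -d i)⟩

theorem exists_isReducedSVD {I : Type*} {M : Matrix I (Fin n) ℝ} (hG : HasTransposeMul M M G)
    (hM : ∀ y, M *ᵥ y = 0 → y = 0) :
    ∃ (U : Matrix I (Fin n) ℝ) (s : Fin n → ℝ) (V : Matrix (Fin n) (Fin n) ℝ),
      IsReducedSVD M U s V := by
  obtain ⟨V, e, hanti, hV⟩ := exists_antitone_isSpectralDecomposition (hG.posDef hM).1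
  have he := hV.pos (hG.posDef hM)
  have hMV : HasTransposeMul (M * V) (M * V) (Matrix.diagonal e) := by
    rw [← hV.transpose_mul_mul_self, Matrix.mul_assoc]
    exact (hG.mul_right V).mul_left V
  refine ⟨M * V * Matrix.diagonal fun i => (√(e i))⁻¹, fun i => √(e i), V, isReducedSVD_iff.2
    ⟨fun i => Real.sqrt_pos.2 (he i), fun i j hij => Real.sqrt_le_sqrt (hanti hij),
      hMV.mul_diagonal_inv_sqrt he, hasTransposeMul_iff.2 hV.transpose_mul_self, ?_⟩⟩
  rw [Matrix.mul_assoc (M * V), diagonal_inv_sqrt_mul_diagonal_sqrt he, Matrix.mul_one,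
    Matrix.mul_assoc, mul_eq_one_comm.1 hV.transpose_mul_self, Matrix.mul_one]

end SpectralDecomposition

section Balancing

variable {n : ℕ} {P Q X Y U V : Matrix (Fin n) (Fin n) ℝ} {d : Fin n → ℝ}

theorem exists_isReducedSVD_transpose_mul (hPX : Pᵀ * X = 1) (hQY : Qᵀ * Y = 1) :
    ∃ (U : Matrix (Fin n) (Fin n) ℝ) (s : Fin n → ℝ) (V : Matrix (Fin n) (Fin n) ℝ),
      IsReducedSVD (Xᵀ * Y) U s V := by
  refine exists_isReducedSVD (hasTransposeMul_iff.2 rfl) fun y hy => ?_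
  have hinv : Qᵀ * (P * Xᵀ) * Y = 1 := by
    rw [← Matrix.transpose_transpose P, ← Matrix.transpose_mul, mul_eq_one_comm.1 hPX,
      Matrix.transpose_one, Matrix.mul_one, hQY]
  calc y = (Qᵀ * P) *ᵥ ((Xᵀ * Y) *ᵥ y) := by
        rw [Matrix.mulVec_mulVec, ← Matrix.mul_assoc, Matrix.mul_assoc Qᵀ, hinv,
          Matrix.one_mulVec]
    _ = 0 := by rw [hy, Matrix.mulVec_zero]

theorem balancing_mul_eq_one (hPX : Pᵀ * X = 1) (hQY : Qᵀ * Y = 1)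
    (h : IsReducedSVD (Xᵀ * Y) U d V) :
    ((Matrix.diagonal fun i => √(d i)) * (Q * V)ᵀ) * (P * U * Matrix.diagonal fun i => √(d i)) =
      1 := by
  obtain ⟨-, -, -, -, hXY⟩ := isReducedSVD_iff.1 h
  refine mul_eq_one_comm.1 ?_
  set E := Matrix.diagonal fun i => √(d i)
  calc P * U * E * (E * (Q * V)ᵀ) = P * (U * (E * E) * Vᵀ) * Qᵀ := by
        simp only [Matrix.transpose_mul, Matrix.mul_assoc]
    _ = (X * Pᵀ)ᵀ * (Y * Qᵀ) := by
        rw [diagonal_sqrt_mul_diagonal_sqrt fun i => (h.pos i).le, ← hXY]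
        simp only [Matrix.transpose_mul, Matrix.transpose_transpose, Matrix.mul_assoc]
    _ = 1 := by
        rw [mul_eq_one_comm.1 hPX, mul_eq_one_comm.1 hQY, Matrix.transpose_one, Matrix.mul_one]

theorem balancing_gram (hPX : Pᵀ * X = 1) (hU : Uᵀ * U = 1) (hd : ∀ i, 0 ≤ d i) :
    (P * U * Matrix.diagonal fun i => √(d i))ᵀ *
      ((X * Xᵀ) * (P * U * Matrix.diagonal fun i => √(d i))) = Matrix.diagonal d := by
  have hXP : Xᵀ * P = 1 := by
    rw [← Matrix.transpose_transpose P, ← Matrix.transpose_mul, hPX, Matrix.transpose_one]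
  set E := Matrix.diagonal fun i => √(d i) with hE
  calc (P * U * E)ᵀ * ((X * Xᵀ) * (P * U * E))
      = E * (Uᵀ * ((Pᵀ * X) * ((Xᵀ * P) * U))) * E := by
        simp only [hE, Matrix.transpose_mul, Matrix.diagonal_transpose, Matrix.mul_assoc]
    _ = Matrix.diagonal d := by
        rw [hPX, hXP, Matrix.one_mul, Matrix.one_mul, hU, Matrix.mul_one,
          diagonal_sqrt_mul_diagonal_sqrt hd]

end Balancing

/-! ### Forward and backward vectors -/

section Words

variable {α : Type*}

/-- Reversal of words as a permutation; it transports sums over words between `A` and `A.rev`. -/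
def reverseEquiv (α : Type*) : List α ≃ List α :=
  List.reverse_involutive.toPerm

theorem hasSum_tsum_cons {g : List α → ℝ} (hg : Summable g) :
    HasSum (fun a => ∑' x, g (a :: x)) (∑' x, g x - g []) := by
  classical
  have hcons : Function.Injective fun p : α × List α => p.1 :: p.2 := fun p q h =>
    Prod.ext (List.cons.inj h).1 (List.cons.inj h).2
  have hvanish : ∀ x ∉ Set.range (fun p : α × List α => p.1 :: p.2),
      Function.update g [] 0 x = 0 := by
    rintro (_ | ⟨a, x⟩) hx
    · exact Function.update_self ..
    · exact absurd ⟨(a, x), rfl⟩ hx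
  have htail : HasSum (fun p : α × List α => g (p.1 :: p.2)) (∑' x, g x - g []) := by
    have hupdate := (hcons.hasSum_iff hvanish).2 (hg.hasSum.update [] 0)
    simpa [Function.comp_def, sub_eq_neg_add] using hupdate
  exact htail.prod_fiberwise fun a =>
    (hg.comp_injective (List.cons_injective (a := a))).hasSum

end Words

namespace WFA

variable {α : Type*} {n : ℕ}

@[simp]
theorem word_nil (A : WFA α n) : A.word [] = 1 := rfl

@[simp]
theorem word_cons (A : WFA α n) (a : α) (x : List α) :
    A.word (a :: x) = A.trans a * A.word x := rfl

theorem word_append (A : WFA α n) (x y : List α) : A.word (x ++ y) = A.word x * A.word y := by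
  simp only [word, List.map_append, List.prod_append]

/-- The matrix whose row at the word `x` is the forward vector `α₀ᵀ A_x`. It is the left factor
in the rank factorization of the Hankel matrix. -/
def forward (A : WFA α n) : Matrix (List α) (Fin n) ℝ :=
  .of fun x => A.init ᵥ* A.word x

/-- The matrix whose row at the word `x` is the backward vector `A_x α_∞`. Its transpose is the
right factor in the rank factorization of the Hankel matrix. -/
def backward (A : WFA α n) : Matrix (List α) (Fin n) ℝ :=
  .of fun x => A.word x *ᵥ A.final

@[simp]
theorem backward_nil (A : WFA α n) : A.backward [] = A.final :=
  Matrix.one_mulVec _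

theorem backward_append (A : WFA α n) (x y : List α) :
    A.backward (x ++ y) = A.word x *ᵥ A.backward y :=
  (congrArg (· *ᵥ A.final) (A.word_append x y)).trans (Matrix.mulVec_mulVec ..).symm

@[simp]
theorem backward_cons (A : WFA α n) (a : α) (x : List α) :
    A.backward (a :: x) = A.trans a *ᵥ A.backward x := by
  simpa only [List.singleton_append, word_cons, word_nil, Matrix.mul_one] using
    A.backward_append [a] x

theorem fn_eq_init_dotProduct (A : WFA α n) (x : List α) : A.fn x = A.init ⬝ᵥ A.backward x :=
  rfl

theorem fn_append (A : WFA α n) (x y : List α) : A.fn (x ++ y) = A.forward x ⬝ᵥ A.backward y := by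
  rw [fn_eq_init_dotProduct, backward_append, Matrix.dotProduct_mulVec]
  rfl

theorem hankel_fn (A : WFA α n) : hankel A.fn = A.forward * A.backwardᵀ :=
  Matrix.ext A.fn_append

/-- The automaton that reads words backwards. It exchanges the roles of forward and backward
vectors. -/
def rev (A : WFA α n) : WFA α n where
  init := A.final
  final := A.init
  trans a := (A.trans a)ᵀ

theorem rev_rev (A : WFA α n) : A.rev.rev = A := rfl

theorem word_rev (A : WFA α n) (x : List α) : A.rev.word x = (A.word x.reverse)ᵀ := by
  induction x with
  | nil => simp only [word_nil, List.reverse_nil, Matrix.transpose_one]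
  | cons a x ih =>
    rw [word_cons, ih, List.reverse_cons, word_append, Matrix.transpose_mul, word_cons, word_nil,
      Matrix.mul_one]
    rfl

theorem backward_rev (A : WFA α n) :
    A.rev.backward = A.forward.submatrix (reverseEquiv α) id :=
  funext fun x => (congrArg (· *ᵥ A.init) (A.word_rev x)).trans (Matrix.mulVec_transpose ..)

theorem forward_rev (A : WFA α n) :
    A.rev.forward = A.backward.submatrix (reverseEquiv α) id :=
  funext fun x => (congrArg (A.final ᵥ* ·) (A.word_rev x)).trans (Matrix.vecMul_transpose ..)

theorem fn_rev (A : WFA α n) (x : List α) : A.rev.fn x = A.fn x.reverse := by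
  rw [fn_eq_init_dotProduct, backward_rev, dotProduct_comm, ← List.append_nil x.reverse, fn_append,
    backward_nil]
  rfl

theorem summable_abs_fn_rev {A : WFA α n} (hf : Summable fun x => |A.fn x|) :
    Summable fun x => |A.rev.fn x| := by
  simp only [fn_rev]
  exact hf.comp_injective List.reverse_injective

section Minimal

theorem exists_fn_eq_of_invariant (A : WFA α n) (W : Submodule ℝ (Fin n → ℝ))
    (hfinal : A.final ∈ W) (htrans : ∀ a, ∀ v ∈ W, A.trans a *ᵥ v ∈ W) :
    ∃ B : WFA α (Module.finrank ℝ W), B.fn = A.fn := by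
  let b := Module.finBasis ℝ W
  let T : α → W →ₗ[ℝ] W := fun a => (A.trans a).mulVecLin.restrict (htrans a)
  have hmem : ∀ x, A.backward x ∈ W := fun x => by
    induction x with
    | nil => simpa only [backward_nil] using hfinal
    | cons a x ih => simpa only [backward_cons] using htrans a _ ih
  let B : WFA α (Module.finrank ℝ W) :=
    ⟨fun i => A.init ⬝ᵥ b i, b.repr ⟨A.final, hfinal⟩, fun a => (T a).toMatrix b b⟩
  have hB : ∀ x, B.backward x = b.repr ⟨A.backward x, hmem x⟩ := fun x => by
    induction x with
    | nil => simp only [backward_nil, B]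
    | cons a x ih =>
      rw [backward_cons, ih, LinearMap.toMatrix_mulVec_repr]
      exact congrArg (fun w => ⇑(b.repr w)) (Subtype.ext (A.backward_cons a x).symm)
  refine ⟨B, funext fun x => ?_⟩
  have hrepr := congrArg (A.init ⬝ᵥ ·) (congrArg Subtype.val (b.sum_repr ⟨A.backward x, hmem x⟩))
  simp only [Submodule.coe_sum, Submodule.coe_smul, dotProduct_sum, dotProduct_smul] at hrepr
  rw [fn_eq_init_dotProduct, fn_eq_init_dotProduct, hB, ← hrepr]
  exact sum_congr rfl fun i _ => mul_comm _ _

theorem seriesRank_le (A : WFA α n) : seriesRank A.fn ≤ n :=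
  Nat.sInf_le ⟨A, rfl⟩

namespace IsMinimal

variable {A : WFA α n}

theorem rev (hA : A.IsMinimal) : A.rev.IsMinimal := by
  refine le_antisymm ?_ A.rev.seriesRank_le
  obtain ⟨B, hB⟩ := Nat.sInf_mem (s := {m | ∃ B : WFA α m, B.fn = A.rev.fn}) ⟨n, A.rev, rfl⟩
  have hBA : B.rev.fn = A.fn := funext fun x => by
    rw [fn_rev, hB, fn_rev, List.reverse_reverse]
  calc n = seriesRank B.rev.fn := hBA ▸ hA
    _ ≤ seriesRank A.rev.fn := B.rev.seriesRank_le

theorem span_range_backward (hA : A.IsMinimal) :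
    Submodule.span ℝ (Set.range A.backward) = ⊤ := by
  obtain ⟨B, hB⟩ := A.exists_fn_eq_of_invariant (Submodule.span ℝ (Set.range A.backward))
    (Submodule.subset_span ⟨[], A.backward_nil⟩) fun a v hv => by
      suffices hle : Submodule.span ℝ (Set.range A.backward) ≤
          (Submodule.span ℝ (Set.range A.backward)).comap (A.trans a).mulVecLin from hle hv
      rw [Submodule.span_le]
      rintro _ ⟨x, rfl⟩
      exact Submodule.subset_span ⟨a :: x, A.backward_cons a x⟩
  refine Submodule.eq_top_of_finrank_eq ((Submodule.finrank_le _).antisymm ?_)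
  calc Module.finrank ℝ (Fin n → ℝ) = n := Module.finrank_fin_fun ℝ
    _ = seriesRank B.fn := hB ▸ hA
    _ ≤ _ := B.seriesRank_le

theorem eq_zero_of_backward_mulVec (hA : A.IsMinimal) {v : Fin n → ℝ}
    (hv : A.backward *ᵥ v = 0) : v = 0 := by
  have hker : Submodule.span ℝ (Set.range A.backward) ≤
      LinearMap.ker (dotProductBilin ℝ ℝ v) := by
    rw [Submodule.span_le]
    rintro _ ⟨x, rfl⟩
    exact (dotProduct_comm _ _).trans (congrFun hv x)
  rw [hA.span_range_backward] at hker
  exact dotProduct_self_eq_zero.1 (hker (Submodule.mem_top (x := v)))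

theorem eq_zero_of_forward_mulVec (hA : A.IsMinimal) {v : Fin n → ℝ}
    (hv : A.forward *ᵥ v = 0) : v = 0 :=
  hA.rev.eq_zero_of_backward_mulVec <| funext fun x => by
    rw [backward_rev]
    exact congrFun hv x.reverse

theorem summable_abs_forward (hA : A.IsMinimal) (hf : Summable fun x => |A.fn x|) (i : Fin n) :
    Summable fun x => |A.forward x i| := by
  have hspan : ∀ v ∈ Submodule.span ℝ (Set.range A.backward),
      Summable fun x => A.forward x ⬝ᵥ v := fun v hv => by
    induction hv using Submodule.span_induction with
    | mem v hv =>
      obtain ⟨y, rfl⟩ := hv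
      simp only [← fn_append]
      exact hf.of_abs.comp_injective (List.append_left_injective y)
    | zero => simpa only [dotProduct_zero] using summable_zero
    | add v w _ _ hv hw => simpa only [dotProduct_add] using hv.add hw
    | smul c v _ hv => simpa only [dotProduct_smul] using hv.const_smul c
  simpa only [dotProduct_single_one] using
    (hspan (Pi.single i 1) (hA.span_range_backward ▸ Submodule.mem_top)).abs

theorem summable_abs_backward (hA : A.IsMinimal) (hf : Summable fun x => |A.fn x|) (i : Fin n) :
    Summable fun x => |A.backward x i| := by
  have hforward := hA.rev.summable_abs_forward (summable_abs_fn_rev hf) i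
  rw [forward_rev] at hforward
  exact (reverseEquiv α).summable_iff.1 hforward

end IsMinimal

end Minimal

end WFA

/-! ### The Stein equation -/

theorem mul_transpose_apply_eq_mulVec {I m n : Type*} [Fintype n] (U : Matrix I n ℝ)
    (X : Matrix m n ℝ) (x : I) : (U * Xᵀ) x = X *ᵥ U x :=
  (Matrix.mul_apply_eq_vecMul ..).trans (Matrix.vecMul_transpose ..)

namespace WFA

variable {α : Type*} [Fintype α] {n : ℕ}

theorem stein_backward {A : WFA α n} {G : Matrix (Fin n) (Fin n) ℝ}
    (hG : HasTransposeMul A.backward A.backward G) :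
    G = Matrix.vecMulVec A.final A.final + ∑ a, A.trans a * G * (A.trans a)ᵀ := by
  ext i j
  have hcons : ∀ a, ∑' x, A.backward (a :: x) i * A.backward (a :: x) j =
      (A.trans a * G * (A.trans a)ᵀ) i j := fun a => by
    have ha := ((hG.mul_right (A.trans a)ᵀ).mul_left (A.trans a)ᵀ i j).tsum_eq
    rw [Matrix.transpose_transpose, ← Matrix.mul_assoc] at ha
    simpa only [backward_cons, mul_transpose_apply_eq_mulVec] using ha
  have hsum := (hasSum_fintype _).unique (hasSum_tsum_cons (hG i j).summable)
  simp only [hcons, (hG i j).tsum_eq, backward_nil] at hsum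
  rw [Matrix.add_apply, Matrix.sum_apply, hsum, Matrix.vecMulVec_apply, add_sub_cancel]

theorem tensorSq_mulVec_vec (A : WFA α n) (X : Matrix (Fin n) (Fin n) ℝ) :
    A.tensorSq *ᵥ X.vec = (∑ a, A.trans a * X * (A.trans a)ᵀ).vec := by
  simp only [tensorSq, Matrix.sum_mulVec, Matrix.kronecker_mulVec_vec, Matrix.vec_sum]

theorem vec_vecMul_tensorSq (A : WFA α n) (X : Matrix (Fin n) (Fin n) ℝ) :
    X.vec ᵥ* A.tensorSq = (∑ a, (A.trans a)ᵀ * X * A.trans a).vec := by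
  simp only [tensorSq, Matrix.vecMul_sum, Matrix.vec_vecMul_kronecker, Matrix.vec_sum]

theorem tensorSq_rev (A : WFA α n) : A.rev.tensorSq = A.tensorSqᵀ := by
  simp only [tensorSq, Matrix.transpose_sum, Matrix.kroneckerMap_transpose, rev]

theorem gramP_eq_gramS_rev (A : WFA α n) : A.gramP = A.rev.gramS := by
  have htranspose : (1 - A.tensorSqᵀ)⁻¹ = ((1 - A.tensorSq)⁻¹)ᵀ := by
    rw [Matrix.transpose_nonsing_inv, Matrix.transpose_sub, Matrix.transpose_one]
  simp only [gramP, gramS, tensorSq_rev, htranspose, Matrix.mulVec_transpose]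
  rfl

theorem gramS_eq {A : WFA α n} {G : Matrix (Fin n) (Fin n) ℝ} (hA : IsUnit (1 - A.tensorSq))
    (hG : HasTransposeMul A.backward A.backward G) : A.gramS = G := by
  have hdet := (Matrix.isUnit_iff_isUnit_det _).1 hA
  have hstein : (1 - A.tensorSq) *ᵥ G.vec = fun k => A.final k.1 * A.final k.2 := by
    rw [Matrix.sub_mulVec, Matrix.one_mulVec, tensorSq_mulVec_vec, ← Matrix.vec_sub,
      sub_eq_iff_eq_add.2 (stein_backward hG)]
    exact funext fun k => mul_comm _ _
  ext i j
  rw [gramS, Matrix.of_apply, ← hstein, Matrix.mulVec_mulVec, Matrix.nonsing_inv_mul _ hdet,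
    Matrix.one_mulVec]
  exact hG.isSymm.apply i j

namespace IsMinimal

variable {A : WFA α n}

theorem eq_zero_of_eq_sum_transpose_mul_mul (hA : A.IsMinimal)
    (hf : Summable fun x => |A.fn x|) {X : Matrix (Fin n) (Fin n) ℝ}
    (hX : X = ∑ a, (A.trans a)ᵀ * X * A.trans a) : X = 0 := by
  have hzero : ∀ p q, A.backward p ⬝ᵥ X *ᵥ A.backward q = 0 := fun p q => by
    let g : List α → ℝ := fun x => A.backward (x ++ p) ⬝ᵥ X *ᵥ A.backward (x ++ q)
    have hrow : ∀ p i, Summable fun x => |A.backward.submatrix (· ++ p) id x i| := fun p i =>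
      (hA.summable_abs_backward hf i).comp_injective (List.append_left_injective p)
    obtain ⟨K, hK⟩ := exists_hasTransposeMul_of_summable_abs (hrow p) (hrow q)
    have hg : Summable g := summable_sum fun i _ => by
      have hi := (hK.mul_right Xᵀ i i).summable
      simp only [mul_transpose_apply_eq_mulVec] at hi
      exact hi
    have hcons : ∀ x, g x = ∑ a, g (a :: x) := fun x => by
      simp only [g]
      conv_lhs => rw [hX]
      simp only [Matrix.sum_mulVec, dotProduct_sum, List.cons_append, backward_cons,
        Matrix.dotProduct_mulVec, ← Matrix.vecMul_vecMul, Matrix.vecMul_transpose]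
    have hfibers : ∑ a, ∑' x, g (a :: x) = ∑' x, g x := by
      rw [← Summable.tsum_finsetSum (f := fun a x => g (a :: x)) fun a _ =>
        hg.comp_injective List.cons_injective]
      exact (tsum_congr hcons).symm
    have hnil := hfibers.symm.trans ((hasSum_fintype _).unique (hasSum_tsum_cons hg))
    exact sub_eq_self.1 hnil.symm
  have hXbackward : ∀ q, X *ᵥ A.backward q = 0 := fun q =>
    hA.eq_zero_of_backward_mulVec (funext fun p => hzero p q)
  exact funext fun i => hA.eq_zero_of_backward_mulVec <| funext fun q =>
    (dotProduct_comm _ _).trans (congrFun (hXbackward q) i)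

theorem isUnit_one_sub_tensorSq (hA : A.IsMinimal) (hf : Summable fun x => |A.fn x|) :
    IsUnit (1 - A.tensorSq) := by
  rw [Matrix.isUnit_iff_isUnit_det, isUnit_iff_ne_zero, Ne, ← Matrix.exists_vecMul_eq_zero_iff]
  rintro ⟨v, hv, hker⟩
  obtain ⟨X, rfl⟩ := Matrix.vec_bijective.surjective v
  rw [Matrix.vecMul_sub, Matrix.vecMul_one, vec_vecMul_tensorSq, sub_eq_zero,
    Matrix.vec_inj] at hker
  exact hv (Matrix.vec_eq_zero_iff.2 (hA.eq_zero_of_eq_sum_transpose_mul_mul hf hker))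

theorem gramS_spec (hA : A.IsMinimal) (hf : Summable fun x => |A.fn x|) :
    HasTransposeMul A.backward A.backward A.gramS := by
  obtain ⟨G, hG⟩ := exists_hasTransposeMul_of_summable_abs (hA.summable_abs_backward hf)
    (hA.summable_abs_backward hf)
  rwa [gramS_eq (hA.isUnit_one_sub_tensorSq hf) hG]

theorem gramP_spec (hA : A.IsMinimal) (hf : Summable fun x => |A.fn x|) :
    HasTransposeMul A.forward A.forward A.gramP := by
  have hforward : A.forward = A.rev.backward.submatrix (reverseEquiv α) id := A.rev.forward_rev
  rw [gramP_eq_gramS_rev, hforward]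
  exact (hA.rev.gramS_spec (summable_abs_fn_rev hf)).submatrix (reverseEquiv α)

end IsMinimal

end WFA

/-! ### Balancing -/

theorem mul_diagonal_inv_sqrt_mul_transpose {I ι : Type*} [Fintype ι] [DecidableEq ι] {d : ι → ℝ}
    (P : Matrix I ι ℝ) (hd : ∀ i, 0 < d i) :
    (P * Matrix.diagonal fun i => (√(d i))⁻¹) * Matrix.diagonal d *
      (P * Matrix.diagonal fun i => (√(d i))⁻¹)ᵀ = P * Pᵀ := by
  have hE := diagonal_inv_sqrt_mul_diagonal_sqrt hd
  rw [← diagonal_sqrt_mul_diagonal_sqrt fun i => (hd i).le, Matrix.transpose_mul,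
    Matrix.diagonal_transpose, Matrix.mul_assoc P, ← Matrix.mul_assoc _ _ (Matrix.diagonal _), hE,
    Matrix.one_mul, Matrix.mul_assoc P, ← Matrix.mul_assoc _ _ Pᵀ, mul_eq_one_comm.1 hE,
    Matrix.one_mul]

namespace WFA

variable {α : Type*} {n m : ℕ}

section Transform

theorem transform_one_one (A : WFA α n) : A.transform 1 1 = A := by
  simp only [transform, Matrix.transpose_one, Matrix.one_mulVec, Matrix.one_mul, Matrix.mul_one]

theorem trans_transform_one (A : WFA α n) (P : Matrix (Fin n) (Fin n) ℝ) (a : α) :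
    (A.transform 1 P).trans a = A.trans a * P :=
  congrArg (· * P) (Matrix.one_mul _)

theorem final_transform_one (A : WFA α n) (P : Matrix (Fin n) (Fin n) ℝ) :
    (A.transform 1 P).final = A.final :=
  Matrix.one_mulVec _

theorem rev_transform (A : WFA α n) (L : Matrix (Fin m) (Fin n) ℝ) (R : Matrix (Fin n) (Fin m) ℝ) :
    (A.transform L R).rev = A.rev.transform Rᵀ Lᵀ := by
  simp only [rev, transform, Matrix.transpose_mul, Matrix.transpose_transpose, Matrix.mul_assoc]

theorem backward_transform_apply (A : WFA α n) (L : Matrix (Fin m) (Fin n) ℝ)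
    (R : Matrix (Fin n) (Fin m) ℝ) (x : List α) :
    (A.transform L R).backward x = L *ᵥ (A.transform 1 (R * L)).backward x := by
  induction x with
  | nil =>
    rw [backward_nil, backward_nil, final_transform_one]
    rfl
  | cons a x ih =>
    have htrans : (A.transform L R).trans a * L = L * (A.transform 1 (R * L)).trans a := by
      simp only [transform, Matrix.one_mul, Matrix.mul_assoc]
    rw [backward_cons, backward_cons, ih, Matrix.mulVec_mulVec, Matrix.mulVec_mulVec, htrans]

theorem fn_transform_eq_fn_transform_one (A : WFA α n) (L : Matrix (Fin m) (Fin n) ℝ)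
    (R : Matrix (Fin n) (Fin m) ℝ) : (A.transform L R).fn = (A.transform 1 (R * L)).fn := by
  funext x
  rw [fn_eq_init_dotProduct, fn_eq_init_dotProduct, backward_transform_apply,
    Matrix.dotProduct_mulVec]
  simp only [transform, Matrix.transpose_mul, ← Matrix.mulVec_transpose, Matrix.mulVec_mulVec]

variable {A : WFA α n} {L R : Matrix (Fin n) (Fin n) ℝ}

theorem fn_transform (hLR : L * R = 1) : (A.transform L R).fn = A.fn := by
  rw [fn_transform_eq_fn_transform_one, mul_eq_one_comm.1 hLR, transform_one_one]

theorem backward_transform (hLR : L * R = 1) : (A.transform L R).backward = A.backward * Lᵀ :=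
  funext fun x => by
    rw [backward_transform_apply, mul_eq_one_comm.1 hLR, transform_one_one,
      mul_transpose_apply_eq_mulVec]

theorem forward_transform (hLR : L * R = 1) : (A.transform L R).forward = A.forward * R := by
  have hLRt : Rᵀ * Lᵀ = 1 := by rw [← Matrix.transpose_mul, hLR, Matrix.transpose_one]
  rw [← rev_rev (A.transform L R), forward_rev, rev_transform, backward_transform hLRt,
    Matrix.transpose_transpose, ← rev_rev A, forward_rev, rev_rev]
  rfl

end Transform

section SVA

/-- `A` is a singular value automaton with Hankel singular values `d`: the forward vectors and the
backward vectors have the same Gram matrix `diag(d)`. This is what ComputeSVA produces. -/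
structure IsSVA (A : WFA α n) (d : Fin n → ℝ) : Prop where
  pos : ∀ i, 0 < d i
  antitone : Antitone d
  forward_gram : HasTransposeMul A.forward A.forward (Matrix.diagonal d)
  backward_gram : HasTransposeMul A.backward A.backward (Matrix.diagonal d)

namespace IsSVA

variable {A B : WFA α n} {d e : Fin n → ℝ}

theorem isReducedSVD_hankel (h : A.IsSVA d) :
    IsReducedSVD (hankel A.fn) (A.forward * Matrix.diagonal fun i => (√(d i))⁻¹) d
      (A.backward * Matrix.diagonal fun i => (√(d i))⁻¹) := by
  rw [hankel_fn]
  exact isReducedSVD_mul_transpose h.pos h.antitone h.forward_gram h.backward_gram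

theorem isHankelSingularValues (h : A.IsSVA d) : IsHankelSingularValues A.fn d :=
  ⟨_, _, h.isReducedSVD_hankel⟩

theorem forward_mul_transpose_unique (hA : A.IsSVA d) (hB : B.IsSVA e) (hAB : A.fn = B.fn) :
    A.forward * A.forwardᵀ = B.forward * B.forwardᵀ := by
  have hpolar := (hAB ▸ hA.isReducedSVD_hankel).polar_unique hB.isReducedSVD_hankel
  rwa [mul_diagonal_inv_sqrt_mul_transpose _ hA.pos,
    mul_diagonal_inv_sqrt_mul_transpose _ hB.pos] at hpolar

end IsSVA

namespace IsMinimal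

variable [Fintype α] {A A' : WFA α n}

theorem gramP_posDef (hA : A.IsMinimal) (hf : Summable fun x => |A.fn x|) : A.gramP.PosDef :=
  (hA.gramP_spec hf).posDef fun _ => hA.eq_zero_of_forward_mulVec

theorem gramS_posDef (hA : A.IsMinimal) (hf : Summable fun x => |A.fn x|) : A.gramS.PosDef :=
  (hA.gramS_spec hf).posDef fun _ => hA.eq_zero_of_backward_mulVec

theorem exists_isSVA_of_computeSVA (hA : A.IsMinimal) (hf : Summable fun x => |A.fn x|)
    (h : ComputeSVA A A') : ∃ d, A'.IsSVA d ∧ A'.fn = A.fn := by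
  obtain ⟨Vp, Vs, U, V, dp, ds, d, hp, hs, hUV, rfl⟩ := h
  have hdp := hp.pos (hA.gramP_posDef hf)
  have hds := hs.pos (hA.gramS_posDef hf)
  have hX := hp.sqrt_mul_transpose fun i => (hdp i).le
  have hY := hs.sqrt_mul_transpose fun i => (hds i).le
  have hPX := hp.inv_sqrt_transpose_mul_sqrt hdp
  have hQY := hs.inv_sqrt_transpose_mul_sqrt hds
  obtain ⟨-, -, hU, hV, -⟩ := isReducedSVD_iff.1 hUV
  have hXY : (Vp * Matrix.diagonal fun i => √(dp i))ᵀ * (Vs * Matrix.diagonal fun i => √(ds i)) =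
      Matrix.diagonal (fun i => √(dp i)) * Vpᵀ * Vs * Matrix.diagonal fun i => √(ds i) := by
    simp only [Matrix.transpose_mul, Matrix.diagonal_transpose, Matrix.mul_assoc]
  have hLR := balancing_mul_eq_one hPX hQY (hXY ▸ hUV)
  refine ⟨d, ⟨hUV.pos, hUV.antitone, ?_, ?_⟩, fn_transform hLR⟩
  · rw [forward_transform hLR,
      ← balancing_gram hPX (hasTransposeMul_iff.1 hU) fun i => (hUV.pos i).le, hX]
    exact ((hA.gramP_spec hf).mul_right _).mul_left _
  · rw [backward_transform hLR, Matrix.transpose_mul, Matrix.transpose_transpose,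
      Matrix.diagonal_transpose,
      ← balancing_gram hQY (hasTransposeMul_iff.1 hV) fun i => (hUV.pos i).le, hY]
    exact ((hA.gramS_spec hf).mul_right _).mul_left _

theorem exists_computeSVA (hA : A.IsMinimal) (hf : Summable fun x => |A.fn x|) :
    ∃ A', ComputeSVA A A' := by
  obtain ⟨Vp, dp, hp⟩ := exists_isSpectralDecomposition (hA.gramP_posDef hf).1
  obtain ⟨Vs, ds, hs⟩ := exists_isSpectralDecomposition (hA.gramS_posDef hf).1
  obtain ⟨U, d, V, hUV⟩ := exists_isReducedSVD_transpose_mul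
    (hp.inv_sqrt_transpose_mul_sqrt (hp.pos (hA.gramP_posDef hf)))
    (hs.inv_sqrt_transpose_mul_sqrt (hs.pos (hA.gramS_posDef hf)))
  rw [Matrix.transpose_mul, Matrix.diagonal_transpose, ← Matrix.mul_assoc] at hUV
  exact ⟨_, Vp, Vs, U, V, dp, ds, d, hp, hs, hUV, rfl⟩

end IsMinimal

end SVA

end WFA

/-! ### Convolution over the free monoid -/

section Cuts

variable {α : Type*}

theorem take_drop_bijective : Function.Bijective
    fun p : Σ x : List α, Fin (x.length + 1) => (p.1.take p.2, p.1.drop p.2) := by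
  refine ⟨?_, fun ⟨x, y⟩ => ⟨⟨x ++ y, ⟨x.length, by simp only [List.length_append]; omega⟩⟩,
    Prod.ext List.take_left List.drop_left⟩⟩
  rintro ⟨x, k, hk⟩ ⟨y, l, hl⟩ h
  obtain ⟨htake, hdrop⟩ := Prod.mk.inj h
  obtain rfl : x = y := by
    rw [← List.take_append_drop k x, htake, hdrop, List.take_append_drop]
  have hlength := congrArg List.length htake
  simp only [List.length_take] at hlength
  obtain rfl : k = l := by omega
  rfl

theorem hasSum_sum_take_drop {F : List α × List α → ℝ} {s : ℝ} (hF : HasSum F s) :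
    HasSum (fun x : List α => ∑ k ∈ range (x.length + 1), F (x.take k, x.drop k)) s := by
  have hcuts := ((Equiv.ofBijective _ take_drop_bijective).hasSum_iff.2 hF).sigma
    fun x => hasSum_fintype _
  exact funext (fun x : List α =>
    Fin.sum_univ_eq_sum_range (fun k => F (x.take k, x.drop k)) _) ▸ hcuts

theorem sum_take_le_tsum {a : List α → ℝ} (ha : ∀ x, 0 ≤ a x) (hsum : Summable a) (x : List α) :
    ∑ k ∈ range (x.length + 1), a (x.take k) ≤ ∑' y, a y := by
  classical
  have hinj : Set.InjOn (fun k => x.take k) (range (x.length + 1)) := fun k hk l hl h => by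
    have hlength := congrArg List.length h
    simp only [List.length_take] at hlength
    simp only [coe_range, Set.mem_Iio] at hk hl
    omega
  rw [← sum_image (f := a) hinj]
  exact hsum.sum_le_tsum _ fun y _ => ha y

theorem sq_sum_take_mul_drop_le {a b : List α → ℝ} (ha : ∀ x, 0 ≤ a x) (hsum : Summable a)
    (x : List α) : (∑ k ∈ range (x.length + 1), a (x.take k) * b (x.drop k)) ^ 2 ≤
      (∑' y, a y) * ∑ k ∈ range (x.length + 1), a (x.take k) * b (x.drop k) ^ 2 := by
  have hterm : ∀ k, 0 ≤ a (x.take k) * b (x.drop k) ^ 2 := fun k =>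
    mul_nonneg (ha _) (sq_nonneg _)
  calc _ ≤ (∑ k ∈ range (x.length + 1), a (x.take k)) *
          ∑ k ∈ range (x.length + 1), a (x.take k) * b (x.drop k) ^ 2 :=
        sum_sq_le_sum_mul_sum_of_sq_le_mul _ (fun _ _ => ha _) (fun _ _ => hterm _)
          fun _ _ => by ring_nf; rfl
    _ ≤ _ := mul_le_mul_of_nonneg_right (sum_take_le_tsum ha hsum x)
        (sum_nonneg fun _ _ => hterm _)

/- Young's inequality `‖a ∗ b‖₂ ≤ ‖a‖₁ ‖b‖₂` for the convolution of the free monoid. -/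
theorem tsum_sq_le_of_abs_le_sum_take_mul_drop {a b e : List α → ℝ} (ha : ∀ x, 0 ≤ a x)
    (hsum : Summable a) (hb : Summable fun x => b x ^ 2)
    (he : ∀ x, |e x| ≤ ∑ k ∈ range (x.length + 1), a (x.take k) * b (x.drop k)) :
    Summable (fun x => e x ^ 2) ∧
      ∑' x, e x ^ 2 ≤ (∑' x, a x) ^ 2 * ∑' x, b x ^ 2 := by
  have hprod : HasSum (fun p : List α × List α => a p.1 * b p.2 ^ 2)
      ((∑' x, a x) * ∑' x, b x ^ 2) :=
    hsum.hasSum.mul hb.hasSum (hsum.mul_of_nonneg hb ha fun x => sq_nonneg _)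
  have hbound := (hasSum_sum_take_drop hprod).mul_left (∑' x, a x)
  have hle : ∀ x, e x ^ 2 ≤
      (∑' y, a y) * ∑ k ∈ range (x.length + 1), a (x.take k) * b (x.drop k) ^ 2 := fun x =>
    calc e x ^ 2 = |e x| ^ 2 := (sq_abs _).symm
      _ ≤ (∑ k ∈ range (x.length + 1), a (x.take k) * b (x.drop k)) ^ 2 :=
        pow_le_pow_left₀ (abs_nonneg _) (he x) 2
      _ ≤ _ := sq_sum_take_mul_drop_le ha hsum x
  have he2 : Summable fun x => e x ^ 2 :=
    .of_nonneg_of_le (fun _ => sq_nonneg _) hle hbound.summable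
  refine ⟨he2, ?_⟩
  rw [sq (∑' x, a x), mul_assoc]
  exact (he2.tsum_le_tsum hle hbound.summable).trans_eq hbound.tsum_eq

end Cuts

section Lyapunov

variable {α β : Type*} [Fintype α] {T : β → α → β} {c q : β → ℝ}

theorem tsum_length_lt_foldl_le (hq0 : ∀ y, 0 ≤ q y) (hq : ∀ y, c y + ∑ a, q (T y a) ≤ q y)
    (N : ℕ) (y : β) :
    ∑' x : List α, (if x.length < N then c (x.foldl T y) else 0) ≤ q y := by
  induction N generalizing y with
  | zero => simpa only [not_lt_zero, if_false, tsum_zero] using hq0 y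
  | succ N ih =>
    have hfinite : Summable fun x : List α =>
        if x.length < N + 1 then c (x.foldl T y) else 0 :=
      summable_of_hasFiniteSupport <| (List.finite_length_lt α (N + 1)).subset fun x hx =>
        not_not.1 fun hlt => hx (if_neg hlt)
    have hcons := (hasSum_fintype _).unique (hasSum_tsum_cons hfinite)
    simp only [List.length_cons, Nat.add_lt_add_iff_right, List.foldl_cons, List.length_nil,
      Nat.succ_pos, if_true, List.foldl_nil] at hcons
    linarith [sum_le_sum fun a (_ : a ∈ univ) => ih (T y a), hq y]

theorem sum_foldl_le (hc : ∀ y, 0 ≤ c y) (hq0 : ∀ y, 0 ≤ q y)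
    (hq : ∀ y, c y + ∑ a, q (T y a) ≤ q y) (F : Finset (List α)) (y : β) :
    ∑ x ∈ F, c (x.foldl T y) ≤ q y := by
  let N := F.sup List.length + 1
  have hlt : ∀ x ∈ F, x.length < N := fun x hx => Nat.lt_succ_of_le (le_sup (f := List.length) hx)
  refine le_trans ?_ (tsum_length_lt_foldl_le hq0 hq N y)
  rw [← sum_congr rfl fun x hx => if_pos (hlt x hx)]
  refine Summable.sum_le_tsum F (fun x _ => ?_) <|
    summable_of_hasFiniteSupport <| (List.finite_length_lt α N).subset fun x hx =>
      not_not.1 fun hlt => hx (if_neg hlt)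
  split_ifs
  exacts [hc _, le_rfl]

end Lyapunov

/-! ### The truncation error -/

namespace WFA

variable {α : Type*} {n : ℕ}

/- Both automata read the word from the right, so they differ by one defect `1 - P` for each
position at which the word can be cut. -/
theorem dotProduct_backward_sub_eq_sum (A : WFA α n) (P : Matrix (Fin n) (Fin n) ℝ) (x : List α)
    (o : Fin n → ℝ) :
    o ⬝ᵥ A.backward x - o ⬝ᵥ P *ᵥ (A.transform 1 P).backward x =
      ∑ k ∈ range (x.length + 1),
        (o ᵥ* A.word (x.take k)) ⬝ᵥ (1 - P) *ᵥ (A.transform 1 P).backward (x.drop k) := by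
  induction x generalizing o with
  | nil => simp [final_transform_one, Matrix.sub_mulVec]
  | cons a x ih =>
    rw [List.length_cons, sum_range_succ']
    simp only [List.take_succ_cons, List.drop_succ_cons, word_cons, ← Matrix.vecMul_vecMul,
      List.take_zero, List.drop_zero, word_nil, Matrix.vecMul_one, Matrix.sub_mulVec,
      Matrix.one_mulVec, dotProduct_sub] at ih ⊢
    have hstep : (A.transform 1 P).backward (a :: x) =
        A.trans a *ᵥ P *ᵥ (A.transform 1 P).backward x := by
      rw [backward_cons, Matrix.mulVec_mulVec, trans_transform_one]
    rw [← ih, backward_cons, hstep, ← Matrix.dotProduct_mulVec, ← Matrix.dotProduct_mulVec]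
    ring

theorem fn_sub_fn_transform_one (A : WFA α n) (P : Matrix (Fin n) (Fin n) ℝ) (x : List α) :
    A.fn x - (A.transform 1 P).fn x = ∑ k ∈ range (x.length + 1),
      A.forward (x.take k) ⬝ᵥ (1 - P) *ᵥ (A.transform 1 P).backward (x.drop k) := by
  have hinit : (A.transform 1 P).fn x = A.init ⬝ᵥ P *ᵥ (A.transform 1 P).backward x := by
    rw [fn_eq_init_dotProduct, Matrix.dotProduct_mulVec, ← Matrix.mulVec_transpose]
    rfl
  rw [hinit, fn_eq_init_dotProduct, dotProduct_backward_sub_eq_sum]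
  rfl

theorem foldl_vecMul_trans (A : WFA α n) (x : List α) (y : Fin n → ℝ) :
    x.foldl (fun z a => z ᵥ* A.trans a) y = y ᵥ* A.word x := by
  induction x generalizing y with
  | nil => exact (Matrix.vecMul_one y).symm
  | cons a x ih => rw [List.foldl_cons, ih, word_cons, Matrix.vecMul_vecMul]

variable {A : WFA α n} {G P : Matrix (Fin n) (Fin n) ℝ}

theorem stein_backward_quadratic [Fintype α] (hG : HasTransposeMul A.backward A.backward G)
    (y : Fin n → ℝ) :
    y ⬝ᵥ G *ᵥ y = (y ⬝ᵥ A.final) ^ 2 +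
      ∑ a, (y ᵥ* A.trans a) ⬝ᵥ G *ᵥ (y ᵥ* A.trans a) := by
  conv_lhs => rw [stein_backward hG]
  simp only [Matrix.add_mulVec, Matrix.sum_mulVec, dotProduct_add, dotProduct_sum,
    ← Matrix.mulVec_mulVec, Matrix.mulVec_transpose, Matrix.vecMulVec_mulVec]
  simp only [Matrix.dotProduct_mulVec, sq]
  simp [dotProduct_comm]

variable [Finite α]

theorem sum_sq_dotProduct_backward_transform_le (hG : HasTransposeMul A.backward A.backward G)
    (hP : ∀ y, (y ᵥ* P) ⬝ᵥ G *ᵥ (y ᵥ* P) ≤ y ⬝ᵥ G *ᵥ y) (F : Finset (List α)) (y : Fin n → ℝ) :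
    ∑ x ∈ F, (y ⬝ᵥ (A.transform 1 P).backward x) ^ 2 ≤ y ⬝ᵥ G *ᵥ y := by
  cases nonempty_fintype α
  have hlyapunov : ∀ y, (y ⬝ᵥ A.final) ^ 2 + ∑ a, (y ᵥ* (A.transform 1 P).trans a) ⬝ᵥ
      G *ᵥ (y ᵥ* (A.transform 1 P).trans a) ≤ y ⬝ᵥ G *ᵥ y := fun y => by
    rw [stein_backward_quadratic hG y]
    simp only [trans_transform_one, ← Matrix.vecMul_vecMul]
    gcongr
    exact hP _
  have hfoldl : ∀ x, (x.foldl (fun z a => z ᵥ* (A.transform 1 P).trans a) y) ⬝ᵥ A.final =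
      y ⬝ᵥ (A.transform 1 P).backward x := fun x => by
    rw [foldl_vecMul_trans, ← Matrix.dotProduct_mulVec, ← final_transform_one A P]
    rfl
  simp only [← hfoldl]
  exact sum_foldl_le (fun _ => sq_nonneg _)
    (fun y => (hG.hasSum_sq_mulVec y).nonneg fun _ => sq_nonneg _) hlyapunov F y

theorem sum_defect_le_trace (hG : HasTransposeMul A.backward A.backward G)
    (hP : ∀ y, (y ᵥ* P) ⬝ᵥ G *ᵥ (y ᵥ* P) ≤ y ⬝ᵥ G *ᵥ y) (D : Matrix (Fin n) (Fin n) ℝ)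
    (F : Finset (List α)) :
    ∑ x ∈ F, (D *ᵥ (A.transform 1 P).backward x) ⬝ᵥ (D *ᵥ (A.transform 1 P).backward x) ≤
      (D * G * Dᵀ).trace := by
  calc _ = ∑ i, ∑ x ∈ F, (D i ⬝ᵥ (A.transform 1 P).backward x) ^ 2 := by
        rw [sum_comm]
        exact sum_congr rfl fun x _ => sum_congr rfl fun i _ => (sq _).symm
    _ ≤ ∑ i, D i ⬝ᵥ G *ᵥ D i :=
        sum_le_sum fun i _ => sum_sq_dotProduct_backward_transform_le hG hP F (D i)
    _ = (D * G * Dᵀ).trace := sum_congr rfl fun i _ => by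
        rw [Matrix.mul_assoc]
        rfl

theorem tsum_sq_fn_sub_fn_transform_one_le (hG : HasTransposeMul A.backward A.backward G)
    (hP : ∀ y, (y ᵥ* P) ⬝ᵥ G *ᵥ (y ᵥ* P) ≤ y ⬝ᵥ G *ᵥ y)
    (hforward : Summable fun x => √(A.forward x ⬝ᵥ A.forward x)) :
    Summable (fun x => (A.fn x - (A.transform 1 P).fn x) ^ 2) ∧
      ∑' x, (A.fn x - (A.transform 1 P).fn x) ^ 2 ≤
        (∑' x, √(A.forward x ⬝ᵥ A.forward x)) ^ 2 * ((1 - P) * G * (1 - P)ᵀ).trace := by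
  let r : List α → Fin n → ℝ := fun x => (1 - P) *ᵥ (A.transform 1 P).backward x
  have hnonneg : ∀ y : Fin n → ℝ, 0 ≤ y ⬝ᵥ y := fun y => sum_nonneg fun i _ => mul_self_nonneg (y i)
  have hle : ∀ F : Finset (List α), ∑ x ∈ F, √(r x ⬝ᵥ r x) ^ 2 ≤
      ((1 - P) * G * (1 - P)ᵀ).trace := fun F => by
    simp only [Real.sq_sqrt (hnonneg _)]
    exact sum_defect_le_trace hG hP (1 - P) F
  have hsummable := summable_of_sum_le (fun _ => sq_nonneg _) hle
  have herror : ∀ x, |A.fn x - (A.transform 1 P).fn x| ≤ ∑ k ∈ range (x.length + 1),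
      √(A.forward (x.take k) ⬝ᵥ A.forward (x.take k)) * √(r (x.drop k) ⬝ᵥ r (x.drop k)) :=
    fun x => by
      rw [fn_sub_fn_transform_one]
      refine (abs_sum_le_sum_abs _ _).trans (sum_le_sum fun k _ => ?_)
      rw [← Real.sqrt_mul (hnonneg _)]
      refine Real.abs_le_sqrt ((sum_mul_sq_le_sq_mul_sq _ _ _).trans_eq ?_)
      simp only [dotProduct, sq]
      rfl
  obtain ⟨herror_summable, herror_le⟩ := tsum_sq_le_of_abs_le_sum_take_mul_drop
    (fun _ => Real.sqrt_nonneg _) hforward hsummable herror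
  exact ⟨herror_summable, herror_le.trans
    (mul_le_mul_of_nonneg_left (hsummable.tsum_le_of_sum_le hle) (sq_nonneg _))⟩

end WFA

theorem truncMatrix_transpose_mul_self (m n : ℕ) :
    (truncMatrix m n)ᵀ * truncMatrix m n =
      Matrix.diagonal fun i : Fin n => if (i : ℕ) < m then 1 else 0 := by
  ext i j
  simp only [Matrix.mul_apply, Matrix.transpose_apply, truncMatrix, Matrix.of_apply, ite_mul,
    one_mul, zero_mul, Matrix.diagonal_apply, Fin.ext_iff]
  by_cases hi : (i : ℕ) < m
  · rw [sum_eq_single (⟨i, hi⟩ : Fin m) (fun k _ hk => if_neg fun h => hk (Fin.ext h)) (by simp)]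
    simp only [if_true, hi]
  · rw [sum_eq_zero fun k _ => if_neg fun h => hi (by omega), if_neg hi, ite_self]

theorem sum_filter_le_sqrt_sum_mul_sqrt {ι : Type*} [Fintype ι] {s : ι → ℝ} (hs : ∀ i, 0 ≤ s i)
    (p : ι → Prop) [DecidablePred p] :
    ∑ i with p i, s i ≤ √(∑ i, s i) * √(∑ i with p i, s i) := by
  calc ∑ i with p i, s i = √(∑ i with p i, s i) * √(∑ i with p i, s i) :=
        (Real.mul_self_sqrt (sum_nonneg fun i _ => hs i)).symm
    _ ≤ _ := by
        gcongr
        exacts [fun i _ _ => hs i, subset_univ _]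

namespace WFA

variable {α : Type*} {n : ℕ}

theorem IsMinimal.summable_sqrt_forward {A : WFA α n} (hA : A.IsMinimal)
    (hf : Summable fun x => |A.fn x|) : Summable fun x => √(A.forward x ⬝ᵥ A.forward x) := by
  refine .of_nonneg_of_le (fun _ => Real.sqrt_nonneg _) (fun x => ?_)
    (summable_sum fun i (_ : i ∈ univ) => hA.summable_abs_forward hf i)
  rw [Real.sqrt_le_left (sum_nonneg fun _ _ => abs_nonneg _)]
  simpa only [dotProduct, sq_abs, ← sq] using
    sum_sq_le_sq_sum_of_nonneg fun i (_ : i ∈ univ) => abs_nonneg (A.forward x i)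

theorem IsSVA.tsum_sq_fn_sub_fn_transform_truncMatrix_le [Finite α] {A : WFA α n}
    {d : Fin n → ℝ} (h : A.IsSVA d) (hforward : Summable fun x => √(A.forward x ⬝ᵥ A.forward x))
    (m : ℕ) :
    Summable (fun x =>
        (A.fn x - (A.transform (truncMatrix m n) (truncMatrix m n)ᵀ).fn x) ^ 2) ∧
      ∑' x, (A.fn x - (A.transform (truncMatrix m n) (truncMatrix m n)ᵀ).fn x) ^ 2 ≤
        (∑' x, √(A.forward x ⬝ᵥ A.forward x)) ^ 2 * ∑ i with m ≤ (i : Fin n).val, d i := by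
  let w : Fin n → ℝ := fun i => if (i : ℕ) < m then 1 else 0
  have hcontract : ∀ y, (y ᵥ* Matrix.diagonal w) ⬝ᵥ
      Matrix.diagonal d *ᵥ (y ᵥ* Matrix.diagonal w) ≤ y ⬝ᵥ Matrix.diagonal d *ᵥ y := fun y => by
    refine sum_le_sum fun i _ => ?_
    simp only [Matrix.vecMul_diagonal, Matrix.mulVec_diagonal, w]
    split_ifs
    · simp only [mul_one, le_refl]
    · nlinarith [mul_nonneg (h.pos i).le (sq_nonneg (y i))]
  have htrace : ((1 - Matrix.diagonal w) * Matrix.diagonal d * (1 - Matrix.diagonal w)ᵀ).trace =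
      ∑ i with m ≤ (i : Fin n).val, d i := by
    rw [← Matrix.diagonal_one, Matrix.diagonal_sub, Matrix.diagonal_transpose,
      Matrix.diagonal_mul_diagonal, Matrix.diagonal_mul_diagonal, Matrix.trace_diagonal, sum_filter]
    refine sum_congr rfl fun i _ => ?_
    by_cases hi : (i : ℕ) < m
    · simp [w, hi, not_le.2 hi]
    · simp [w, hi, not_lt.1 hi]
  rw [fn_transform_eq_fn_transform_one, truncMatrix_transpose_mul_self, ← htrace]
  exact tsum_sq_fn_sub_fn_transform_one_le h.backward_gram hcontract hforward

end WFA

theorem IsHankelSingularValues.unique {α : Type*} {n : ℕ} {f : List α → ℝ} {s s' : Fin n → ℝ}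
    (h : IsHankelSingularValues f s) (h' : IsHankelSingularValues f s') : s = s' := by
  obtain ⟨_, _, hs⟩ := h
  obtain ⟨_, _, hs'⟩ := h'
  exact hs.singularValues_unique hs'

theorem IsHankelSingularValues.pos {α : Type*} {n : ℕ} {f : List α → ℝ} {s : Fin n → ℝ}
    (h : IsHankelSingularValues f s) (i : Fin n) : 0 < s i := by
  obtain ⟨_, _, hs⟩ := h
  exact hs.pos i

theorem WFA.IsMinimal.exists_isSVA {α : Type*} [Finite α] {n : ℕ} {A : WFA α n}
    (hA : A.IsMinimal) (hf : Summable fun x => |A.fn x|) :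
    ∃ (A' : WFA α n) (d : Fin n → ℝ), A'.IsSVA d ∧ A'.fn = A.fn := by
  cases nonempty_fintype α
  obtain ⟨A', hAA'⟩ := hA.exists_computeSVA hf
  exact ⟨A', hA.exists_isSVA_of_computeSVA hf hAA'⟩

theorem IsRational.exists_isMinimal {α : Type*} {n : ℕ} {f : List α → ℝ} (hf : IsRational f)
    (hn : seriesRank f = n) : ∃ A : WFA α n, A.IsMinimal ∧ A.fn = f := by
  obtain ⟨A, hA⟩ : ∃ A : WFA α (seriesRank f), A.fn = f := Nat.sInf_mem hf
  subst hn
  exact ⟨A, congrArg seriesRank hA.symm, hA⟩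

theorem SVATruncation.tsum_sq_fn_sub_fn_le {α : Type*} [Fintype α] {n m : ℕ} {A A₀ : WFA α n}
    {B : WFA α m} {s : Fin n → ℝ} (hB : SVATruncation A m B) (hA : A.IsMinimal)
    (hf : Summable fun x => |A.fn x|) (hA₀ : A₀.IsSVA s) (hA₀A : A₀.fn = A.fn) :
    Summable (fun x => (A.fn x - B.fn x) ^ 2) ∧
      ∑' x, (A.fn x - B.fn x) ^ 2 ≤
        (∑' x, √(A₀.forward x ⬝ᵥ A₀.forward x)) ^ 2 * ∑ i with m ≤ (i : Fin n).val, s i := by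
  obtain ⟨A', hAA', rfl⟩ := hB
  obtain ⟨d, hA', hA'A⟩ := hA.exists_isSVA_of_computeSVA hf hAA'
  have hA'A₀ : A'.fn = A₀.fn := hA'A.trans hA₀A.symm
  obtain rfl : d = s :=
    (hA'A₀ ▸ hA'.isHankelSingularValues).unique hA₀.isHankelSingularValues
  have hforward : ∀ x, A'.forward x ⬝ᵥ A'.forward x = A₀.forward x ⬝ᵥ A₀.forward x := fun x =>
    congrFun₂ (hA'.forward_mul_transpose_unique hA₀ hA'A₀) x x
  have hmin : A'.IsMinimal := hA.trans (congrArg seriesRank hA'A.symm)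
  have herror := hA'.tsum_sq_fn_sub_fn_transform_truncMatrix_le
    (hmin.summable_sqrt_forward (by rwa [hA'A])) m
  simpa only [hA'A, hforward] using herror

end

theorem mainTheorem1_general {α : Type*} [Fintype α] (f : List α → ℝ) (hrat : IsRational f)
    (hf : Summable fun x => |f x|) (n : ℕ) (hn : seriesRank f = n) :
    (∃! s : Fin n → ℝ, IsHankelSingularValues f s) ∧
    ∃ C : ℝ, 0 < C ∧
      ∀ s : Fin n → ℝ, IsHankelSingularValues f s →
      ∀ (m : ℕ) (A : WFA α n), A.fn = f →
        (∃ B : WFA α m, SVATruncation A m B) ∧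
        ∀ B : WFA α m, SVATruncation A m B →
          Summable (fun x => (f x - B.fn x) ^ 2) ∧
          ∑' x, (f x - B.fn x) ^ 2 ≤
            C * ∑ i ∈ Finset.univ.filter (fun i : Fin n => m ≤ (i : ℕ)), s i := by
  obtain ⟨A₁, hA₁, rfl⟩ := hrat.exists_isMinimal hn
  obtain ⟨A₀, d, hA₀, hA₀A₁⟩ := hA₁.exists_isSVA hf
  have hd : IsHankelSingularValues A₁.fn d := hA₀A₁ ▸ hA₀.isHankelSingularValues
  refine ⟨⟨d, hd, fun s hs => hs.unique hd⟩,
    (∑' x, √(A₀.forward x ⬝ᵥ A₀.forward x)) ^ 2 + 1, by positivity, fun s hs m A hA => ?_⟩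
  obtain rfl := hs.unique hd
  have hmin : A.IsMinimal := hA₁.trans (congrArg seriesRank hA.symm)
  rw [← hA] at hf hA₀A₁ ⊢
  obtain ⟨A', hAA'⟩ := hmin.exists_computeSVA hf
  refine ⟨⟨_, A', hAA', rfl⟩, fun B hB => ?_⟩
  refine (hB.tsum_sq_fn_sub_fn_le hmin hf hA₀ hA₀A₁).imp_right fun hle => hle.trans ?_
  exact mul_le_mul_of_nonneg_right (le_add_of_nonneg_right zero_le_one)
    (Finset.sum_nonneg fun i _ => (hd.pos i).le)

theorem mainTheorem1 {α : Type*} [Fintype α] (f : List α → ℝ) (hrat : IsRational f)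
    (hf : Summable fun x => |f x|) (n : ℕ) (hn : seriesRank f = n) :
    (∃ s : Fin n → ℝ, IsHankelSingularValues f s) ∧
    ∃ C : ℝ, 0 < C ∧
      ∀ s : Fin n → ℝ, IsHankelSingularValues f s →
      ∀ m : ℕ, 0 < m → m < n →
      ∀ A : WFA α n, A.IsMinimal → A.fn = f → matrixSpectralRadius A.tensorSq < 1 →
        (∃ B : WFA α m, SVATruncation A m B) ∧
        ∀ B : WFA α m, SVATruncation A m B →
          Summable (fun x => (f x - B.fn x) ^ 2) ∧
          ∑' x, (f x - B.fn x) ^ 2 ≤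
            C * √(∑ i ∈ Finset.univ.filter (fun i : Fin n => m ≤ (i : ℕ)), s i) := by
  obtain ⟨⟨d, hd, hunique⟩, C, hC, hbound⟩ := mainTheorem1_general f hrat hf n hn
  refine ⟨⟨d, hd⟩, C * (√(∑ i, d i) + 1), by positivity, fun s hs m _ _ A _ hA _ =>
    ⟨(hbound s hs m A hA).1, fun B hB => ((hbound s hs m A hA).2 B hB).imp_right fun hle => ?_⟩⟩
  obtain rfl := hunique s hs
  rw [mul_assoc]
  refine hle.trans (mul_le_mul_of_nonneg_left ?_ hC.le)
  exact (sum_filter_le_sqrt_sum_mul_sqrt (fun i => (hd.pos i).le) _).trans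
    (mul_le_mul_of_nonneg_right (le_add_of_nonneg_right zero_le_one) (Real.sqrt_nonneg _))
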